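/- Let $G$ be a graph on the vertices $1,\dots,n$, and let $\mathbf p=(\mathbf p_1,\dots,\mathbf p_n)$ be a configuration of points in $\mathbb R^d$ such that $\mathbf p_i\neq\mathbf p_j$ for every edge $ij$ of $G$. Let $\ell$ be the dimension of the affine span of $\mathbf p$. A configuration $\mathbf q$ is called $\ell$-pinned if $\mathbf q_1=0$ and, for $2\le i\le \ell+1$, $\mathbf q_i$ lies in the span of the first $i-1$ coordinate vectors. Assume that $\mathbf p$ is pinned, that is, $\mathbf p$ is $\ell$-pinned and $\mathbf p_1,\dots,\mathbf p_{\ell+1}$ are affinely independent. The framework $(G,\mathbf p)$ is rigid if every configuration $\mathbf q$ close enough to $\mathbf p$ with $|\mathbf q_i-\mathbf q_j|=|\mathbf p_i-\mathbf p_j|$ for all edges $ij$ satisfies these equations for all pairs $ij$; otherwise it is flexible. A trajectory at $\mathbf p$ is a non-constant analytic map $\mathbf p(t)$, $t\in[0,\varepsilon]$ with $\varepsilon>0$, into the $\ell$-pinned configurations, with $\mathbf p(0)=\mathbf p$. For integers $j,k\ge 1$, a $(j,k)$-flex is a trajectory $\mathbf p(t)$ at $\mathbf p$ such that $\mathbf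 p^{(i)}(0)=0$ for $1\le i<j$, $\mathbf p^{(j)}(0)\ne0$, and, for each edge $ij$, the derivatives of orders $1,\dots,k$ of $|\mathbf p_i(t)-\mathbf p_j(t)|^2$ vanish at $t=0$. Let $K$ be the linear space formed by $0$ and the velocities $\mathbf p'(0)$ of the $(1,1)$-flexes. A stiff-bar energy is a function $E(\mathbf q)=\sum_{ij\in G}E_{ij}(|\mathbf q_i-\mathbf q_j|)$ of $\ell$-pinned configurations $\mathbf q$ where each $E_{ij}:\mathbb R\to\mathbb R$ is analytic at $d_{ij}=|\mathbf p_i-\mathbf p_j|$, has a strict local minimum there, and satisfies $E_{ij}''(d_{ij})>0$. It has tight growth order $s>0$ at $\mathbf p$ if (a) there is $c_1>0$ such that $E(\mathbf q)-E(\mathbf p)\ge c_1|\mathbf q-\mathbf p|^s$ for all $\ell$-pinned $\mathbf q$ near $\mathbf p$, and (b) there are a trajectory $\mathbf p(t)$ at $\mathbf p$ and $c_2,\delta>0$ such that $E(\mathbf p(t))-E(\mathbf p)\le c_2|\mathbf p(t)-\mathbf p|^s$ for $t\in[0,\delta]$. A rigid framework has rigidity order $\nu\in\mathbb Q$ if every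 stiff-bar energy has tight growth order $2\nu$ at $\mathbf p$. Suppose that $\dim K=1$. Then: 1. If, for some integer $k\ge2$, $(G,\mathbf p)$ has a $(1,k-1)$-flex but no $(1,k)$-flex, then $(G,\mathbf p)$ is rigid and its rigidity order is $k$. 2. If, for some integer $k\ge1$, $(G,\mathbf p)$ has a $(1,k)$-flex, then it is flexible, or it is rigid with a rigidity order $\nu\ge k+1$. 3. (Alexandrov's theorem.) If, for some integer $k\ge1$, $(G,\mathbf p)$ has no $(1,k)$-flex, then it is rigid. -/

import Mathlib

open Set Filter Topology

namespace BarFramework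

/-- Configurations of `n` points in `ℝ^d`, with the Euclidean norm of `ℝ^(nd)`; the entry at
`(i, c)` is the `c`-th coordinate of the `i`-th point. -/
abbrev Config (n d : ℕ) : Type :=
  EuclideanSpace ℝ (Fin n × Fin d)

variable {n d : ℕ}

/-- The `i`-th point of the configuration `q`. -/
def point (q : Config n d) (i : Fin n) : EuclideanSpace ℝ (Fin d) :=
  WithLp.toLp 2 (fun c => q (i, c))

/-- The length of an edge in the configuration `q`. -/
noncomputable def edgeLength (q : Config n d) : Sym2 (Fin n) → ℝ :=
  Sym2.lift ⟨fun i j => ‖point q i - point q j‖, fun i j => norm_sub_rev (point q i) (point q j)⟩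

/-- `(G, p)` and `(G, q)` have the same edge lengths. -/
def IsEquivalent (G : SimpleGraph (Fin n)) (p q : Config n d) : Prop :=
  ∀ e ∈ G.edgeSet, edgeLength p e = edgeLength q e

/-- All pairwise distances agree. -/
def IsCongruent (p q : Config n d) : Prop :=
  ∀ i j : Fin n, ‖point p i - point p j‖ = ‖point q i - point q j‖

/-- Local rigidity in `ℝ^d`, among all configurations (not only the pinned ones). -/
def IsRigid (G : SimpleGraph (Fin n)) (p : Config n d) : Prop :=
  ∃ U ∈ 𝓝 p, ∀ q ∈ U, IsEquivalent G p q → IsCongruent p q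

/-- A framework that is not locally rigid. -/
def IsFlexible (G : SimpleGraph (Fin n)) (p : Config n d) : Prop :=
  ¬ IsRigid G p

/-- The dimension `ℓ` of the affine span of the points of `p`. -/
noncomputable def spanDim (p : Config n d) : ℕ :=
  Module.finrank ℝ (vectorSpan ℝ (Set.range fun i : Fin n => point p i))

/-- `ℓ`-pinned position. Vertices are numbered from `0`, so that for `i ≤ ℓ` the point `point q i` has
to lie in the span of the first `i` coordinate vectors; in particular `point q 0` is the origin. -/
def IsPinnedAt (l : ℕ) (q : Config n d) : Prop :=
  ∀ i : Fin n, (i : ℕ) ≤ l → ∀ c : Fin d, (i : ℕ) ≤ (c : ℕ) → point q i c = 0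

/-- The first `ℓ + 1` points are affinely independent, `ℓ` being the dimension of the affine span. -/
def IsNondegenerate (p : Config n d) : Prop :=
  AffineIndependent ℝ (fun i : {i : Fin n // (i : ℕ) ≤ spanDim p} => point p i.1)

/-- Pinned position. -/
def IsPinned (p : Config n d) : Prop :=
  IsNondegenerate p ∧ IsPinnedAt (spanDim p) p

/-- A trajectory at `p`: analytic on some `[0, ε]` (that is, on a neighbourhood of this interval),
starting at `p`, non-constant and `ℓ`-pinned there. -/
def IsTrajectory (p : Config n d) (γ : ℝ → Config n d) : Prop :=
  ∃ ε : ℝ, 0 < ε ∧ AnalyticOnNhd ℝ γ (Icc 0 ε) ∧ γ 0 = p ∧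
    (∀ t ∈ Icc 0 ε, IsPinnedAt (spanDim p) (γ t)) ∧ ∃ t ∈ Icc 0 ε, γ t ≠ p

/-- The first `k` derivatives vanish at `0`. -/
def IsVanishing {F : Type*} [NormedAddCommGroup F] [NormedSpace ℝ F] (k : ℕ) (f : ℝ → F) : Prop :=
  ∀ i : ℕ, 1 ≤ i → i ≤ k → iteratedDeriv i f 0 = 0

/-- `j`-active, for `j ≥ 1`: `(j-1)`-vanishing but not `j`-vanishing. -/
def IsActive {F : Type*} [NormedAddCommGroup F] [NormedSpace ℝ F] (j : ℕ) (f : ℝ → F) : Prop :=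
  IsVanishing (j - 1) f ∧ ¬ IsVanishing j f

/-- `γ` is a `(j,k)`-flex of `(G, p)`, where `j, k ≥ 1`: a `j`-active trajectory along which all
squared edge lengths are `k`-vanishing. -/
def IsFlex (G : SimpleGraph (Fin n)) (p : Config n d) (j k : ℕ) (γ : ℝ → Config n d) : Prop :=
  1 ≤ j ∧ 1 ≤ k ∧ IsTrajectory p γ ∧ IsActive j γ ∧
    ∀ e ∈ G.edgeSet, IsVanishing k (fun t => edgeLength (γ t) e ^ 2)

/-- `(G, p)` has a `(j,k)`-flex. -/
def HasFlex (G : SimpleGraph (Fin n)) (p : Config n d) (j k : ℕ) : Prop :=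
  ∃ γ : ℝ → Config n d, IsFlex G p j k γ

/-- The linear space `K` of the coefficients `p'` of the `(1,1)`-flexes, together with `0`. -/
def firstOrderFlexes (G : SimpleGraph (Fin n)) (p : Config n d) : Submodule ℝ (Config n d) :=
  Submodule.span ℝ {v | ∃ γ : ℝ → Config n d, IsFlex G p 1 1 γ ∧ deriv γ 0 = v}

/-- The edge-based energy with the edge potentials `E e`, `e` an edge of `G`. -/
noncomputable def energy (G : SimpleGraph (Fin n)) [DecidableRel G.Adj]
    (E : Sym2 (Fin n) → ℝ → ℝ) (q : Config n d) : ℝ :=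
  ∑ e ∈ G.edgeFinset, E e (edgeLength q e)

/-- The potentials `E` define a bar-like energy at `p`. -/
def IsBarLike (G : SimpleGraph (Fin n)) (p : Config n d) (E : Sym2 (Fin n) → ℝ → ℝ) : Prop :=
  ∀ e ∈ G.edgeSet, edgeLength p e ≠ 0 ∧ AnalyticAt ℝ (E e) (edgeLength p e) ∧
    ∀ᶠ x in 𝓝[≠] (edgeLength p e), E e (edgeLength p e) < E e x

/-- The potentials `E` define a stiff-bar energy at `p`. -/
def IsStiffBar (G : SimpleGraph (Fin n)) (p : Config n d) (E : Sym2 (Fin n) → ℝ → ℝ) : Prop :=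
  IsBarLike G p E ∧ ∀ e ∈ G.edgeSet, 0 < iteratedDeriv 2 (E e) (edgeLength p e)

/-- `Φ` grows always-`s`-quickly at `p`, as a function on `ℓ`-pinned configurations. -/
def GrowsQuickly (Φ : Config n d → ℝ) (p : Config n d) (s : ℝ) : Prop :=
  ∃ c : ℝ, 0 < c ∧ ∃ U ∈ 𝓝 p, ∀ q ∈ U, IsPinnedAt (spanDim p) q →
    c * ‖q - p‖ ^ s ≤ Φ q - Φ p

/-- `Φ` grows sometimes-`s`-slowly at `p`, as a function on `ℓ`-pinned configurations. -/
def GrowsSlowly (Φ : Config n d → ℝ) (p : Config n d) (s : ℝ) : Prop :=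
  ∃ γ : ℝ → Config n d, IsTrajectory p γ ∧ ∃ c δ : ℝ, 0 < c ∧ 0 < δ ∧
    ∀ t ∈ Icc 0 δ, Φ (γ t) - Φ p ≤ c * ‖γ t - p‖ ^ s

/-- `s > 0` is the tight growth order of `Φ` at `p`. -/
def HasTightGrowthOrder (Φ : Config n d → ℝ) (p : Config n d) (s : ℝ) : Prop :=
  0 < s ∧ GrowsSlowly Φ p s ∧ GrowsQuickly Φ p s

/-- The framework `(G, p)` is rigid, with rigidity order `ν`: every stiff-bar energy at `p` has
tight growth order `2ν` at `p`. -/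
def HasRigidityOrder (G : SimpleGraph (Fin n)) [DecidableRel G.Adj] (p : Config n d) (ν : ℚ) :
    Prop :=
  IsRigid G p ∧ ∀ E : Sym2 (Fin n) → ℝ → ℝ, IsStiffBar G p E →
    HasTightGrowthOrder (energy G E) p (2 * (ν : ℝ))

end BarFramework

/-! Let `F` send a pinned displacement `x` of `p` to the change of the squared edge lengths. Its
derivative at `0` has kernel `K`, here a line spanned by some `v`. Lyapunov–Schmidt reduction
(`exists_reduced_curve`) gives an analytic curve `γ` with velocity `v` such that every small `x`
lies within a multiple of `‖F x‖` of `γ (φ x)`, where `φ` is a linear functional with `φ v = 1`.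
Everything is then decided by the order of vanishing of the one-variable map `t ↦ F (γ t)`.

If this map vanishes identically, `γ` is an actual motion. The framework is flexible and `γ` is a
`(1,k)`-flex for every `k`. If the order is a finite `m`, then `m ≥ 2`, `γ` is a `(1,m-1)`-flex, and
`‖F x‖ ≥ c ‖x‖ ^ m` near `0`. This growth gives rigidity and excludes `(1,m)`-flexes. Stiff-bar
energies are comparable to `‖F‖ ^ 2` (`IsStiffBar.eventually_energy_bounds`), so their tight growth
order is `2m` and the rigidity order is `m`. The three claims follow from this dichotomy,
`IsPinned.flexible_or_edgeSqGrows`.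

Rigidity concerns all configurations, whereas `F` sees only pinned ones. Two facts bridge the gap:
near `p`, Gram–Schmidt moves a configuration continuously to a congruent pinned one, and pinned
configurations congruent to `p` equal `p`. -/

namespace BarFramework

/-! ### Lyapunov–Schmidt reduction for a one-dimensional kernel -/

section Reduction

variable {V W : Type*} [NormedAddCommGroup V] [NormedSpace ℝ V]
  [NormedAddCommGroup W] [NormedSpace ℝ W] [FiniteDimensional ℝ W]

/-- A linear map with kernel `ℝ ∙ v` has a left inverse modulo its kernel. -/
theorem exists_leftInverse_of_ker_eq_span (A : V →L[ℝ] W) {v : V} {φ : V →L[ℝ] ℝ}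
    (hφ : φ v = 1) (hA : LinearMap.ker A.toLinearMap = Submodule.span ℝ {v}) :
    ∃ B : W →L[ℝ] V, ∀ x, B (A x) = x - φ x • v := by
  have hAv : A v = 0 := by
    have : v ∈ LinearMap.ker A.toLinearMap := hA ▸ Submodule.mem_span_singleton_self v
    simpa using this
  let N := LinearMap.ker φ.toLinearMap
  obtain ⟨g, hg⟩ := LinearMap.exists_leftInverse_of_injective (A.toLinearMap.comp N.subtype) (by
    rw [LinearMap.ker_eq_bot']
    rintro ⟨x, hx⟩ h
    have hx' : φ x = 0 := hx
    have hx2 : x ∈ LinearMap.ker A.toLinearMap := h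
    rw [hA, Submodule.mem_span_singleton] at hx2
    obtain ⟨a, rfl⟩ := hx2
    have : a = 0 := by simpa [hφ] using hx'
    simp [this])
  refine ⟨LinearMap.toContinuousLinearMap (N.subtype.comp g), fun x => ?_⟩
  have hm : x - φ x • v ∈ N := by
    change φ (x - φ x • v) = 0
    simp [hφ]
  have h1 : g (A (x - φ x • v)) = ⟨x - φ x • v, hm⟩ :=
    LinearMap.congr_fun hg ⟨x - φ x • v, hm⟩
  have h2 : A (x - φ x • v) = A x := by simp [hAv]
  rw [h2] at h1
  simp [h1]

variable [FiniteDimensional ℝ V]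

/-- Lyapunov–Schmidt reduction along a one-dimensional kernel. -/
theorem exists_reduced_curve {F : V → W} (hF : AnalyticAt ℝ F 0) (hF0 : F 0 = 0) {v : V}
    (hv : v ≠ 0) (hker : LinearMap.ker (fderiv ℝ F 0).toLinearMap = Submodule.span ℝ {v}) :
    ∃ γ : ℝ → V, AnalyticAt ℝ γ 0 ∧ γ 0 = 0 ∧ HasDerivAt γ v 0 ∧
      ∃ φ : V →L[ℝ] ℝ, ∃ C : ℝ, 0 < C ∧
        ∀ᶠ x in 𝓝 0, ‖F (γ (φ x))‖ ≤ C * ‖F x‖ ∧ ‖x‖ ≤ C * (|φ x| + ‖F x‖) := by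
  obtain ⟨φ, hφ⟩ := SeparatingDual.exists_eq_one (R := ℝ) hv
  obtain ⟨B, hB⟩ := exists_leftInverse_of_ker_eq_span _ hφ hker
  -- `Ψ` has derivative the identity at `0`, hence an analytic local inverse `g`, and the curve is
  -- `g (t • v)`. Both `x = g (Ψ x)` and `g (φ x • v)` are values of `g` at points differing by `B
  -- (F x)`, so Lipschitz bounds for `g` and `F` give the two estimates.
  let Ψ : V → V := fun x => φ x • v + B (F x)
  have hΨ0 : Ψ 0 = 0 := by simp [Ψ, hF0]
  have hΨa : AnalyticAt ℝ Ψ 0 :=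
    ((φ.analyticAt 0).smul analyticAt_const).add (AnalyticAt.fun_comp (B.analyticAt _) hF)
  have hΨd : HasStrictFDerivAt Ψ ((ContinuousLinearEquiv.refl ℝ V : V ≃L[ℝ] V) : V →L[ℝ] V) 0 := by
    have h1 := (φ.hasStrictFDerivAt (x := (0 : V))).smul_const v
    have h2 := B.hasStrictFDerivAt.comp (0 : V) hF.hasStrictFDerivAt
    refine (h1.add h2).congr_fderiv ?_
    ext x
    simp [hB]
  have hF' := hF.hasStrictFDerivAt
  let g := hΨd.localInverse Ψ _ 0
  have hg0 : g 0 = 0 := by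
    have := hΨd.localInverse_apply_image
    rwa [hΨ0] at this
  have hga : AnalyticAt ℝ g 0 := by
    have := (hΨd.toOpenPartialHomeomorph Ψ).analyticAt_symm' (i := ContinuousLinearEquiv.refl ℝ V)
      hΨd.mem_toOpenPartialHomeomorph_source hΨa hΨd.hasFDerivAt.fderiv
    rwa [hΨd.toOpenPartialHomeomorph_coe, hΨ0] at this
  have hgd : HasStrictFDerivAt g (ContinuousLinearMap.id ℝ V) 0 := by
    have := hΨd.to_localInverse
    rw [hΨ0] at this
    exact this
  have hleft : ∀ᶠ x in 𝓝 (0 : V), g (Ψ x) = x := hΨd.eventually_left_inverse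
  have hline : HasDerivAt (fun t : ℝ => t • v) v 0 := by
    simpa using (hasDerivAt_id (0 : ℝ)).smul_const v
  refine ⟨fun t => g (t • v), ?_, by simp [hg0], ?_, φ, ?_⟩
  · refine AnalyticAt.fun_comp (g := g) (f := fun t : ℝ => t • v) (by simpa using hga) ?_
    exact analyticAt_id.smul analyticAt_const
  · have := HasFDerivAt.comp_hasDerivAt (0 : ℝ) (l := g) (l' := ContinuousLinearMap.id ℝ V)
      (f := fun t : ℝ => t • v) (by simpa using hgd.hasFDerivAt) hline
    simpa [Function.comp_def] using this
  obtain ⟨K₁, s, hs, hK₁⟩ := hF'.exists_lipschitzOnWith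
  obtain ⟨K₂, u, hu, hK₂⟩ := hgd.exists_lipschitzOnWith
  have hΨc : Tendsto Ψ (𝓝 0) (𝓝 0) := by simpa [hΨ0] using hΨa.continuousAt.tendsto
  have hφc : Tendsto (fun x => φ x • v) (𝓝 0) (𝓝 0) := by
    have : Continuous fun x => φ x • v := by fun_prop
    simpa using this.tendsto 0
  have hgc : Tendsto g (𝓝 0) (𝓝 0) := by simpa [hg0] using hga.continuousAt.tendsto
  set b := ‖B‖
  have hb : 0 ≤ b := norm_nonneg _
  have hc1 : (0 : ℝ) ≤ K₁ := K₁.2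
  have hc2 : (0 : ℝ) ≤ K₂ := K₂.2
  refine ⟨1 + K₁ * (K₂ * b) + K₂ * (‖v‖ + b), by positivity, ?_⟩
  filter_upwards [hleft, hs, hΨc hu, hφc hu, (hgc.comp hφc) hs] with x hx hxs hxu hxv hxg
  have h0u : (0 : V) ∈ u := mem_of_mem_nhds hu
  have hz : ‖B (F x)‖ ≤ b * ‖F x‖ := B.le_opNorm _
  have hd : ‖g (φ x • v) - x‖ ≤ K₂ * (b * ‖F x‖) := by
    have h := hK₂.norm_sub_le hxv hxu
    rw [hx] at h
    refine h.trans (mul_le_mul_of_nonneg_left ?_ hc2)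
    simpa [Ψ] using hz
  have hn : ‖x‖ ≤ K₂ * (|φ x| * ‖v‖ + b * ‖F x‖) := by
    have h := hK₂.norm_sub_le hxu h0u
    rw [hx, hg0, sub_zero, sub_zero] at h
    refine h.trans (mul_le_mul_of_nonneg_left ((norm_add_le _ _).trans ?_) hc2)
    rw [norm_smul, Real.norm_eq_abs]
    linarith
  have hFx := norm_nonneg (F x)
  have hphi := abs_nonneg (φ x)
  have hvn := norm_nonneg v
  constructor
  · have h := hK₁.norm_sub_le hxg hxs
    have h2 : ‖F (g (φ x • v))‖ ≤ ‖F x‖ + K₁ * (K₂ * (b * ‖F x‖)) := by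
      have h3 := norm_sub_norm_le (F (g (φ x • v))) (F x)
      have h4 := mul_le_mul_of_nonneg_left hd hc1
      simp only [Function.comp_apply] at h
      linarith
    have : 0 ≤ K₂ * (‖v‖ + b) * ‖F x‖ := by positivity
    refine h2.trans ?_
    linarith
  · refine hn.trans ?_
    have e1 : 0 ≤ (1 + K₁ * (K₂ * b)) * (|φ x| + ‖F x‖) := by positivity
    have e2 : 0 ≤ K₂ * (‖v‖ * ‖F x‖ + b * |φ x|) := by positivity
    linarith

/-- Along the reduced curve `F` either vanishes identically, or has a finite order `m ≥ 2`, in which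
case `F` grows at least like the `m`-th power of the distance. -/
theorem exists_curve_vanishing_or_growth {F : V → W} (hF : AnalyticAt ℝ F 0) (hF0 : F 0 = 0)
    {v : V} (hv : v ≠ 0)
    (hker : LinearMap.ker (fderiv ℝ F 0).toLinearMap = Submodule.span ℝ {v}) :
    ∃ γ : ℝ → V, AnalyticAt ℝ γ 0 ∧ γ 0 = 0 ∧ HasDerivAt γ v 0 ∧
      ((∀ᶠ t in 𝓝 0, F (γ t) = 0) ∨
        ∃ m : ℕ, 2 ≤ m ∧ (m : ℕ∞) ≤ analyticOrderAt (fun t => F (γ t)) 0 ∧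
          ∃ c : ℝ, 0 < c ∧ ∀ᶠ x in 𝓝 0, c * ‖x‖ ^ m ≤ ‖F x‖) := by
  obtain ⟨γ, hγ, hγ0, hγd, φ, C, hC, hest⟩ := exists_reduced_curve hF hF0 hv hker
  refine ⟨γ, hγ, hγ0, hγd, ?_⟩
  have hh : AnalyticAt ℝ (fun t => F (γ t)) 0 := AnalyticAt.fun_comp (by rwa [hγ0]) hγ
  by_cases htop : analyticOrderAt (fun t => F (γ t)) 0 = ⊤
  · exact Or.inl (analyticOrderAt_eq_top.1 htop)
  right
  set m := analyticOrderNatAt (fun t => F (γ t)) 0 with hm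
  have hmc : (m : ℕ∞) = analyticOrderAt (fun t => F (γ t)) 0 := Nat.cast_analyticOrderNatAt htop
  obtain ⟨g, hg, hg0, hgeq⟩ := hh.analyticOrderAt_ne_top.1 htop
  have hm2 : 2 ≤ m := by
    have hd : HasDerivAt (fun t => F (γ t)) 0 0 := by
      have h1 : HasFDerivAt F (fderiv ℝ F 0) (γ 0) := by
        rw [hγ0]; exact hF.differentiableAt.hasFDerivAt
      have h2 := h1.comp_hasDerivAt (0 : ℝ) hγd
      have h3 : fderiv ℝ F 0 v = 0 := by
        have : v ∈ LinearMap.ker (fderiv ℝ F 0).toLinearMap :=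
          hker ▸ Submodule.mem_span_singleton_self v
        simpa using this
      rwa [h3] at h2
    have : ((2 : ℕ) : ℕ∞) ≤ analyticOrderAt (fun t => F (γ t)) 0 := by
      rw [natCast_le_analyticOrderAt_iff_iteratedDeriv_eq_zero hh]
      intro i hi
      interval_cases i
      · simp [hγ0, hF0]
      · simpa using hd.deriv
    rw [← hmc] at this
    exact_mod_cast this
  refine ⟨m, hm2, hmc.le, ?_⟩
  have hgn : ∀ᶠ t in 𝓝 (0 : ℝ), ‖g 0‖ / 2 < ‖g t‖ :=
    hg.continuousAt.norm.eventually_const_lt (half_lt_self (norm_pos_iff.2 hg0))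
  have hφt : Tendsto φ (𝓝 0) (𝓝 0) := by simpa using φ.continuous.tendsto 0
  have hFt : ∀ᶠ x in 𝓝 (0 : V), ‖F x‖ < 1 := by
    refine hF.continuousAt.norm.eventually_lt_const ?_
    simp [hF0]
  set a := ‖g 0‖ / 2
  have ha : 0 < a := half_pos (norm_pos_iff.2 hg0)
  -- The factorisation `F (γ t) = t ^ m • g t` with `g 0 ≠ 0` bounds `|φ x| ^ m` by a multiple of
  -- `‖F x‖`; the other term satisfies `‖F x‖ ^ m ≤ ‖F x‖` since `‖F x‖ < 1`.
  have key : ∀ᶠ x in 𝓝 (0 : V), ‖x‖ ^ m ≤ (C ^ m * (2 ^ (m - 1) * (C / a + 1))) * ‖F x‖ := by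
    filter_upwards [hest, hφt hgn, hφt hgeq, hFt] with x hx hgx hgx2 hFx
    have hgx2 : F (γ (φ x)) = (φ x - 0) ^ m • g (φ x) := hgx2
    have hgx : a < ‖g (φ x)‖ := hgx
    have hp : |φ x| ^ m ≤ C / a * ‖F x‖ := by
      have h1 := hx.1
      rw [hgx2, sub_zero, norm_smul, norm_pow, Real.norm_eq_abs] at h1
      have h2 : |φ x| ^ m * a ≤ |φ x| ^ m * ‖g (φ x)‖ :=
        mul_le_mul_of_nonneg_left hgx.le (by positivity)
      rw [div_mul_eq_mul_div, le_div_iff₀ ha]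
      linarith
    have hFm : ‖F x‖ ^ m ≤ ‖F x‖ :=
      pow_le_of_le_one (norm_nonneg _) hFx.le (by omega)
    calc ‖x‖ ^ m ≤ (C * (|φ x| + ‖F x‖)) ^ m := pow_le_pow_left₀ (norm_nonneg _) hx.2 m
      _ = C ^ m * (|φ x| + ‖F x‖) ^ m := mul_pow _ _ _
      _ ≤ C ^ m * (2 ^ (m - 1) * (|φ x| ^ m + ‖F x‖ ^ m)) := by
        gcongr
        exact add_pow_le (abs_nonneg _) (norm_nonneg _) m
      _ ≤ C ^ m * (2 ^ (m - 1) * (C / a * ‖F x‖ + ‖F x‖)) := by gcongr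
      _ = _ := by ring
  have hD : 0 < C ^ m * (2 ^ (m - 1) * (C / a + 1)) := by positivity
  refine ⟨_, inv_pos.2 hD, ?_⟩
  filter_upwards [key] with x hx
  rwa [inv_mul_le_iff₀ hD]

end Reduction

end BarFramework

/-! ### Flexes as orders of vanishing, and `K` as a kernel -/

namespace BarFramework

variable {n d : ℕ}

section Vanishing

variable {F : Type*} [NormedAddCommGroup F] [NormedSpace ℝ F]

/-- `IsVanishing` ignores the value at `0`; subtracting it makes the derivatives of orders `0` to
`k` vanish, whence the exponent `k + 1`. -/
theorem isVanishing_iff [CompleteSpace F] {f : ℝ → F} (hf : AnalyticAt ℝ f 0) (k : ℕ) :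
    IsVanishing k f ↔ ∃ g : ℝ → F, AnalyticAt ℝ g 0 ∧
      ∀ᶠ t in 𝓝 0, f t - f 0 = t ^ (k + 1) • g t := by
  have hf' : AnalyticAt ℝ (fun t => f t - f 0) 0 := hf.fun_sub analyticAt_const
  have h1 := natCast_le_analyticOrderAt hf' (n := k + 1)
  rw [natCast_le_analyticOrderAt_iff_iteratedDeriv_eq_zero hf'] at h1
  simp only [sub_zero] at h1
  rw [← h1]
  have h2 : ∀ i, 1 ≤ i → iteratedDeriv i (fun t => f t - f 0) 0 = iteratedDeriv i f 0 := by
    intro i hi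
    obtain ⟨j, rfl⟩ := Nat.exists_eq_add_of_le' hi
    rw [iteratedDeriv_succ', iteratedDeriv_succ']
    congr 1
    ext t
    simp
  constructor
  · intro h i hi
    rcases Nat.eq_zero_or_pos i with rfl | hpos
    · simp
    · rw [h2 i hpos]
      exact h i hpos (by omega)
  · intro h i hi hik
    rw [← h2 i hi]
    exact h i (by omega)

theorem isActive_one_iff {f : ℝ → F} : IsActive 1 f ↔ deriv f 0 ≠ 0 := by
  have h0 : IsVanishing (1 - 1) f := fun i h1 h2 => by omega
  simp only [IsActive, h0, true_and, not_iff_not]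
  constructor
  · intro h
    simpa using h 1 le_rfl le_rfl
  · intro h i h1 h2
    obtain rfl : i = 1 := by omega
    simpa using h

theorem eventually_mul_abs_le_norm_sub {f : ℝ → F} {v : F} (hf : HasDerivAt f v 0) (hv : v ≠ 0) :
    ∃ c : ℝ, 0 < c ∧ ∀ᶠ t in 𝓝 0, c * |t| ≤ ‖f t - f 0‖ := by
  have hv' : 0 < ‖v‖ / 2 := half_pos (norm_pos_iff.2 hv)
  refine ⟨‖v‖ / 2, hv', ?_⟩
  filter_upwards [(hasDerivAt_iff_isLittleO.1 hf).def hv'] with t ht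
  simp only [sub_zero, Real.norm_eq_abs] at ht
  have h1 := norm_sub_norm_le (t • v) (f t - f 0)
  rw [norm_sub_rev (t • v), norm_smul, Real.norm_eq_abs] at h1
  linarith

end Vanishing

/-- The space of `l`-pinned configurations. -/
def pinnedSubmodule (n d l : ℕ) : Submodule ℝ (Config n d) where
  carrier := {q | IsPinnedAt l q}
  add_mem' {a b} ha hb i hi c hc := by
    have h1 : a (i, c) = 0 := ha i hi c hc
    have h2 : b (i, c) = 0 := hb i hi c hc
    simp [point, h1, h2]
  zero_mem' i hi c hc := by simp [point]
  smul_mem' r a ha i hi c hc := by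
    have h1 : a (i, c) = 0 := ha i hi c hc
    simp [point, h1]

/-- The squared edge lengths of a configuration. -/
noncomputable def edgeSq (G : SimpleGraph (Fin n)) (q : Config n d) : G.edgeSet → ℝ :=
  fun e => edgeLength q e.1 ^ 2

theorem edgeLength_nonneg (q : Config n d) (e : Sym2 (Fin n)) : 0 ≤ edgeLength q e := by
  induction e with
  | h i j => exact norm_nonneg (point q i - point q j)

theorem continuous_point (i : Fin n) : Continuous fun q : Config n d => point q i := by
  unfold point
  fun_prop

theorem continuous_edgeLength (e : Sym2 (Fin n)) :
    Continuous fun q : Config n d => edgeLength q e := by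
  induction e with
  | h i j => exact ((continuous_point i).sub (continuous_point j)).norm

theorem analyticAt_edgeLength_sq (e : Sym2 (Fin n)) (q : Config n d) :
    AnalyticAt ℝ (fun q : Config n d => edgeLength q e ^ 2) q := by
  induction e with
  | h i j =>
    have h : (fun q : Config n d => edgeLength q s(i, j) ^ 2) =
        fun q => ∑ c : Fin d, (q (i, c) - q (j, c)) ^ 2 := by
      ext q
      change ‖point q i - point q j‖ ^ 2 = _
      rw [EuclideanSpace.real_norm_sq_eq]
      rfl
    rw [h]
    refine Finset.analyticAt_fun_sum _ fun c _ => ?_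
    have hp : ∀ x : Fin n × Fin d, AnalyticAt ℝ (fun q : Config n d => q x) q := fun x =>
      (EuclideanSpace.proj x : Config n d →L[ℝ] ℝ).analyticAt q
    exact ((hp (i, c)).fun_sub (hp (j, c))).fun_pow 2

variable (G : SimpleGraph (Fin n))

theorem analyticAt_edgeSq [DecidableRel G.Adj] (q : Config n d) :
    AnalyticAt ℝ (edgeSq (d := d) G) q :=
  AnalyticAt.pi fun e => analyticAt_edgeLength_sq e.1 q

theorem isEquivalent_iff_edgeSq_eq {p q : Config n d} :
    IsEquivalent G p q ↔ edgeSq G q = edgeSq G p := by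
  constructor
  · intro h
    ext e
    simp [edgeSq, h e.1 e.2]
  · intro h e he
    have := congrFun h ⟨e, he⟩
    exact ((sq_eq_sq₀ (edgeLength_nonneg _ _) (edgeLength_nonneg _ _)).1 this).symm

theorem IsTrajectory.analyticAt {p : Config n d} {γ : ℝ → Config n d} (h : IsTrajectory p γ) :
    AnalyticAt ℝ γ 0 := by
  obtain ⟨ε, hε, ha, -⟩ := h
  exact ha 0 ⟨le_rfl, hε.le⟩

theorem IsTrajectory.apply_zero {p : Config n d} {γ : ℝ → Config n d} (h : IsTrajectory p γ) :
    γ 0 = p := by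
  obtain ⟨ε, hε, ha, h0, -⟩ := h
  exact h0

theorem IsTrajectory.eventually_isPinnedAt {p : Config n d} {γ : ℝ → Config n d}
    (h : IsTrajectory p γ) : ∀ᶠ t in 𝓝[≥] 0, IsPinnedAt (spanDim p) (γ t) := by
  obtain ⟨ε, hε, ha, h0, hp, -⟩ := h
  filter_upwards [Icc_mem_nhdsGE hε] with t ht using hp t ht

/-- Pinnedness is known only for `t ≥ 0`, so the velocity is identified through the one-sided
derivative. -/
theorem IsTrajectory.deriv_mem {p : Config n d} {γ : ℝ → Config n d} (h : IsTrajectory p γ) :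
    deriv γ 0 ∈ pinnedSubmodule n d (spanDim p) := by
  intro i hi c hc
  have h1 : HasDerivAt γ (deriv γ 0) 0 := h.analyticAt.differentiableAt.hasDerivAt
  have h2 : HasDerivAt (fun t => γ t (i, c)) (deriv γ 0 (i, c)) 0 :=
    (EuclideanSpace.proj (i, c) : Config n d →L[ℝ] ℝ).hasFDerivAt.comp_hasDerivAt 0 h1
  have h3 : (fun t => γ t (i, c)) =ᶠ[𝓝[≥] 0] fun _ => 0 :=
    h.eventually_isPinnedAt.mono fun t ht => ht i hi c hc
  have h4 : HasDerivWithinAt (fun t => γ t (i, c)) 0 (Ici 0) 0 :=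
    (hasDerivWithinAt_const (0 : ℝ) (Ici 0) (0 : ℝ)).congr_of_eventuallyEq h3
      (h3.self_of_nhdsWithin self_mem_Ici)
  exact (uniqueDiffWithinAt_Ici (0 : ℝ)).eq_deriv _ h2.hasDerivWithinAt h4

/-- A curve germ of pinned displacements with non-zero velocity is a trajectory. -/
theorem isTrajectory_of_hasDerivAt {p : Config n d} (hp : IsPinnedAt (spanDim p) p)
    {γ : ℝ → pinnedSubmodule n d (spanDim p)} (hγ : AnalyticAt ℝ γ 0) (h0 : γ 0 = 0)
    {v : pinnedSubmodule n d (spanDim p)} (hd : HasDerivAt γ v 0) (hv : v ≠ 0) :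
    IsTrajectory p (fun t => p + (γ t : Config n d)) := by
  obtain ⟨r, hr, hball⟩ := Metric.eventually_nhds_iff_ball.1 hγ.eventually_analyticAt
  obtain ⟨c, hc, hev⟩ := eventually_mul_abs_le_norm_sub hd hv
  refine ⟨r / 2, by positivity, ?_, by simp [h0], ?_, ?_⟩
  · intro t ht
    have ht' : t ∈ Metric.ball (0 : ℝ) r := by
      rw [Metric.mem_ball, dist_zero_right, Real.norm_eq_abs, abs_of_nonneg ht.1]
      linarith [ht.2]
    have h1 : AnalyticAt ℝ (fun t => (γ t : Config n d)) t :=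
      ((pinnedSubmodule n d (spanDim p)).subtypeL.analyticAt _).fun_comp (hball t ht')
    exact analyticAt_const.fun_add h1
  · intro t _
    exact (pinnedSubmodule n d (spanDim p)).add_mem hp (γ t).2
  · have h1 : ∀ᶠ t in 𝓝[>] (0 : ℝ), c * |t| ≤ ‖γ t - γ 0‖ := nhdsWithin_le_nhds hev
    have h2 : ∀ᶠ t in 𝓝[>] (0 : ℝ), t ∈ Ioo 0 (r / 2) := Ioo_mem_nhdsGT (by positivity)
    obtain ⟨t, ht, ht2⟩ := (h1.and h2).exists
    refine ⟨t, ⟨ht2.1.le, ht2.2.le⟩, fun hcon => ?_⟩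
    have h3 : γ t = 0 := by simpa using hcon
    rw [h3, h0, sub_self, norm_zero] at ht
    have := mul_pos hc (abs_pos.2 ht2.1.ne')
    linarith

theorem IsFlex.hasDerivAt {G : SimpleGraph (Fin n)} {p : Config n d} {j k : ℕ} {γ : ℝ → Config n d}
    (h : IsFlex G p j k γ) : HasDerivAt γ (deriv γ 0) 0 :=
  h.2.2.1.analyticAt.differentiableAt.hasDerivAt

/-- The change of the squared edge lengths under a pinned displacement of `p`. -/
noncomputable def edgeMap (p : Config n d) (x : pinnedSubmodule n d (spanDim p)) :
    G.edgeSet → ℝ :=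
  edgeSq G (p + (x : Config n d)) - edgeSq G p

@[simp]
theorem edgeMap_zero (p : Config n d) : edgeMap G p 0 = 0 := by simp [edgeMap]

variable [DecidableRel G.Adj]

theorem analyticAt_edgeMap (p : Config n d) : AnalyticAt ℝ (edgeMap G p) 0 := by
  have h1 : AnalyticAt ℝ (fun x : pinnedSubmodule n d (spanDim p) => p + (x : Config n d)) 0 :=
    analyticAt_const.fun_add ((pinnedSubmodule n d (spanDim p)).subtypeL.analyticAt 0)
  exact (AnalyticAt.fun_comp (analyticAt_edgeSq G _) h1).fun_sub analyticAt_const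

theorem fderiv_edgeMap_apply (p : Config n d) (v : pinnedSubmodule n d (spanDim p)) :
    fderiv ℝ (edgeMap G p) 0 v = fderiv ℝ (edgeSq G) p v := by
  have h1 : HasFDerivAt (fun x : pinnedSubmodule n d (spanDim p) => p + (x : Config n d))
      (pinnedSubmodule n d (spanDim p)).subtypeL 0 :=
    ((pinnedSubmodule n d (spanDim p)).subtypeL.hasFDerivAt).const_add p
  have h2 : HasFDerivAt (edgeSq G) (fderiv ℝ (edgeSq G) p)
      (p + ((0 : pinnedSubmodule n d (spanDim p)) : Config n d)) := by
    simpa using (analyticAt_edgeSq G p).differentiableAt.hasFDerivAt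
  have h3 := (h2.comp (0 : pinnedSubmodule n d (spanDim p)) h1).sub_const (edgeSq G p)
  have h4 : HasFDerivAt (edgeMap G p) _ 0 := h3
  rw [h4.fderiv]
  simp

variable {G}

theorem IsTrajectory.analyticAt_edgeLength_sq {p : Config n d} {γ : ℝ → Config n d}
    (h : IsTrajectory p γ) (e : Sym2 (Fin n)) :
    AnalyticAt ℝ (fun t => edgeLength (γ t) e ^ 2) 0 :=
  AnalyticAt.fun_comp (g := fun q : Config n d => edgeLength q e ^ 2)
    (BarFramework.analyticAt_edgeLength_sq e _) h.analyticAt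

theorem IsFlex.edgeSq_isBigO {p : Config n d} {j k : ℕ} {γ : ℝ → Config n d}
    (h : IsFlex G p j k γ) :
    ∃ C : ℝ, 0 < C ∧ ∀ᶠ t in 𝓝 0, ‖edgeSq G (γ t) - edgeSq G p‖ ≤ C * |t| ^ (k + 1) := by
  obtain ⟨-, -, htr, -, hvan⟩ := h
  have h1 : (fun t => edgeSq G (γ t) - edgeSq G p) =O[𝓝 0] fun t : ℝ => t ^ (k + 1) := by
    rw [Asymptotics.isBigO_pi]
    rintro ⟨e, he⟩
    obtain ⟨g, hg, hge⟩ := (isVanishing_iff (htr.analyticAt_edgeLength_sq e) k).1 (hvan e he)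
    have h2 : (fun t => (edgeSq G (γ t) - edgeSq G p) ⟨e, he⟩) =ᶠ[𝓝 0]
        fun t => t ^ (k + 1) * g t := by
      filter_upwards [hge] with t ht
      rw [htr.apply_zero] at ht
      exact ht
    refine h2.trans_isBigO ?_
    simpa using (Asymptotics.isBigO_refl (fun t : ℝ => t ^ (k + 1)) (𝓝 0)).mul
      (hg.continuousAt.isBigO_one ℝ)
  obtain ⟨C, hC, hb⟩ := h1.exists_pos
  refine ⟨C, hC, ?_⟩
  simpa using hb.bound

/-- A curve of pinned displacements along which the squared edge lengths are constant up to
order `k`. -/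
theorem isFlex_one_of_analyticAt {p : Config n d} (hp : IsPinnedAt (spanDim p) p)
    {γ : ℝ → pinnedSubmodule n d (spanDim p)} (hγ : AnalyticAt ℝ γ 0) (h0 : γ 0 = 0)
    {v : pinnedSubmodule n d (spanDim p)} (hd : HasDerivAt γ v 0) (hv : v ≠ 0) {k : ℕ} (hk : 1 ≤ k)
    (hord : ((k + 1 : ℕ) : ℕ∞) ≤ analyticOrderAt (fun t => edgeMap G p (γ t)) 0) :
    IsFlex G p 1 k (fun t => p + (γ t : Config n d)) := by
  have htr := isTrajectory_of_hasDerivAt hp hγ h0 hd hv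
  refine ⟨le_rfl, hk, htr, ?_, ?_⟩
  · rw [isActive_one_iff]
    have h1 : HasDerivAt (fun t => p + (γ t : Config n d)) (v : Config n d) 0 :=
      ((pinnedSubmodule n d (spanDim p)).subtypeL.hasFDerivAt.comp_hasDerivAt 0 hd).const_add p
    rw [h1.deriv]
    simpa using hv
  · intro e he
    rw [isVanishing_iff (htr.analyticAt_edgeLength_sq e)]
    have ha : AnalyticAt ℝ (fun t => edgeMap G p (γ t)) 0 :=
      AnalyticAt.fun_comp (by rw [h0]; exact analyticAt_edgeMap G p) hγ
    obtain ⟨g, hg, hge⟩ := (natCast_le_analyticOrderAt ha).1 hord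
    refine ⟨fun t => g t ⟨e, he⟩, ?_, ?_⟩
    · exact (analyticAt_pi_iff.1 hg) ⟨e, he⟩
    · filter_upwards [hge] with t ht
      have := congrFun ht ⟨e, he⟩
      simpa [edgeMap, edgeSq, h0] using this

theorem isFlex_line {p : Config n d} (hp : IsPinnedAt (spanDim p) p)
    {v : pinnedSubmodule n d (spanDim p)} (hv : v ≠ 0) (hker : fderiv ℝ (edgeMap G p) 0 v = 0) :
    IsFlex G p 1 1 (fun t => p + ((t • v : pinnedSubmodule n d (spanDim p)) : Config n d)) := by
  have hd : HasDerivAt (fun t : ℝ => t • v) v 0 := by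
    simpa using (hasDerivAt_id (0 : ℝ)).smul_const v
  have ha : AnalyticAt ℝ (fun t : ℝ => t • v) 0 := analyticAt_id.smul analyticAt_const
  refine isFlex_one_of_analyticAt hp ha (zero_smul ℝ v) hd hv le_rfl ?_
  have hF : AnalyticAt ℝ (fun t : ℝ => edgeMap G p (t • v)) 0 :=
    AnalyticAt.fun_comp (by rw [zero_smul]; exact analyticAt_edgeMap G p) ha
  rw [natCast_le_analyticOrderAt_iff_iteratedDeriv_eq_zero hF]
  have h1 : HasFDerivAt (edgeMap G p) (fderiv ℝ (edgeMap G p) 0) ((0 : ℝ) • v) := by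
    rw [zero_smul]; exact (analyticAt_edgeMap G p).differentiableAt.hasFDerivAt
  have h2 := h1.comp_hasDerivAt (0 : ℝ) hd
  rw [hker] at h2
  intro i hi
  interval_cases i
  · simp
  · simpa [Function.comp_def] using h2.deriv

/-- The chain rule puts velocities of `(1,1)`-flexes in the kernel; conversely, the straight line
along a non-zero kernel vector is a `(1,1)`-flex. In particular the span in the definition of `K`
adds nothing. -/
theorem firstOrderFlexes_eq_map_ker {p : Config n d} (hp : IsPinnedAt (spanDim p) p) :
    firstOrderFlexes G p = (LinearMap.ker (fderiv ℝ (edgeMap G p) 0).toLinearMap).map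
      (pinnedSubmodule n d (spanDim p)).subtype := by
  apply le_antisymm
  · refine Submodule.span_le.2 ?_
    rintro _ ⟨γ, hγ, rfl⟩
    refine ⟨⟨deriv γ 0, hγ.2.2.1.deriv_mem⟩, ?_, rfl⟩
    change fderiv ℝ (edgeMap G p) 0 _ = 0
    rw [fderiv_edgeMap_apply]
    have h0 := hγ.2.2.1.apply_zero
    have h1 : HasFDerivAt (edgeSq G) (fderiv ℝ (edgeSq G) p) (γ 0) := by
      rw [h0]; exact (analyticAt_edgeSq G p).differentiableAt.hasFDerivAt
    have h2 := hasDerivAt_pi.1 (h1.comp_hasDerivAt (0 : ℝ) hγ.hasDerivAt)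
    ext e
    have h3 := hγ.2.2.2.2 e.1 e.2 1 le_rfl le_rfl
    rw [iteratedDeriv_one] at h3
    rw [← (h2 e).deriv]
    exact h3
  · rintro _ ⟨v, hv, rfl⟩
    by_cases hv0 : v = 0
    · simp [hv0]
    refine Submodule.subset_span ⟨_, isFlex_line hp hv0 hv, ?_⟩
    have hd : HasDerivAt (fun t : ℝ => t • v) v 0 := by
      simpa using (hasDerivAt_id (0 : ℝ)).smul_const v
    exact (((pinnedSubmodule n d (spanDim p)).subtypeL.hasFDerivAt.comp_hasDerivAt 0
      hd).const_add p).deriv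

theorem exists_ker_eq_span {p : Config n d} (hp : IsPinnedAt (spanDim p) p)
    (hK : Module.finrank ℝ (firstOrderFlexes G p) = 1) :
    ∃ v : pinnedSubmodule n d (spanDim p), v ≠ 0 ∧
      LinearMap.ker (fderiv ℝ (edgeMap G p) 0).toLinearMap = Submodule.span ℝ {v} := by
  rw [firstOrderFlexes_eq_map_ker hp, Submodule.finrank_map_subtype_eq] at hK
  obtain ⟨v, hv, hspan⟩ := finrank_eq_one_iff'.1 hK
  refine ⟨v, by simpa using hv, le_antisymm ?_ ?_⟩
  · intro w hw
    obtain ⟨c, hc⟩ := hspan ⟨w, hw⟩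
    exact Submodule.mem_span_singleton.2 ⟨c, congrArg Subtype.val hc⟩
  · rw [Submodule.span_singleton_le_iff_mem]
    exact v.2

end BarFramework

/-! ### Stiff-bar energies versus squared edge lengths -/

namespace BarFramework

variable {n d : ℕ}

/-- A stiff potential is comparable to the square of the change of the squared length. -/
theorem eventually_potential_bounds {f : ℝ → ℝ} {a : ℝ} (ha : a ≠ 0) (hf : AnalyticAt ℝ f a)
    (hmin : ∀ᶠ x in 𝓝[≠] a, f a < f x) (h2 : 0 < iteratedDeriv 2 f a) :
    ∃ c C : ℝ, 0 < c ∧ 0 < C ∧ ∀ᶠ x in 𝓝 a,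
      c * (x ^ 2 - a ^ 2) ^ 2 ≤ f x - f a ∧ f x - f a ≤ C * (x ^ 2 - a ^ 2) ^ 2 := by
  have hf' : AnalyticAt ℝ (fun x => f x - f a) a := hf.fun_sub analyticAt_const
  have hloc : IsLocalMin f a := by
    have := eventually_nhdsWithin_iff.1 hmin
    filter_upwards [this] with x hx
    by_cases hxa : x = a
    · rw [hxa]
    · exact (hx hxa).le
  have hord : analyticOrderAt (fun x => f x - f a) a = (2 : ℕ) := by
    rw [analyticOrderAt_eq_nat_iff_iteratedDeriv_eq_zero hf']
    constructor
    · intro k hk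
      interval_cases k
      · simp
      · simpa using hloc.deriv_eq_zero
    · have : iteratedDeriv 2 (fun x => f x - f a) a = iteratedDeriv 2 f a := by
        have hd : deriv (fun x => f x - f a) = deriv f := by
          ext t
          simp
        rw [iteratedDeriv_succ', hd, ← iteratedDeriv_succ']
      rw [this]
      exact h2.ne'
  obtain ⟨g, hg, hg0, hge⟩ := hf'.analyticOrderAt_eq_natCast.1 hord
  have hgpos : 0 < g a := by
    refine lt_of_le_of_ne ?_ hg0.symm
    refine ge_of_tendsto (hg.continuousAt.tendsto.mono_left (nhdsWithin_le_nhds (s := {a}ᶜ))) ?_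
    filter_upwards [hmin, nhdsWithin_le_nhds hge, self_mem_nhdsWithin] with x hx hxe hxa
    have hxe : f x - f a = (x - a) ^ 2 • g x := hxe
    rw [smul_eq_mul] at hxe
    have h3 : 0 < (x - a) ^ 2 := by
      have : x - a ≠ 0 := sub_ne_zero.2 hxa
      positivity
    exact (pos_of_mul_pos_right (hxe ▸ sub_pos.2 hx) h3.le).le
  -- As `x ^ 2 - a ^ 2 = (x - a) * (x + a)`, this is the quotient of `f x - f a` by `(x ^ 2 - a ^ 2)
  -- ^ 2`, continuous at `a` because `a ≠ 0`.
  let u : ℝ → ℝ := fun x => g x / (x + a) ^ 2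
  have hden : (a + a) ^ 2 ≠ 0 := by
    have : a + a ≠ 0 := by simpa [← two_mul] using ha
    positivity
  have hu : ContinuousAt u a := hg.continuousAt.div (by fun_prop) hden
  have hupos : 0 < u a := div_pos hgpos (by positivity)
  have hne : ∀ᶠ x in 𝓝 a, (x + a) ^ 2 ≠ 0 :=
    ContinuousAt.eventually_ne (g := fun x : ℝ => (x + a) ^ 2) (by fun_prop) hden
  refine ⟨u a / 2, 2 * u a, by positivity, by positivity, ?_⟩
  filter_upwards [hge, hne, hu.eventually_const_lt (half_lt_self hupos),
    hu.eventually_lt_const (show u a < 2 * u a by linarith)] with x hx hxne hlo hhi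
  have hx' : f x - f a = u x * (x ^ 2 - a ^ 2) ^ 2 := by
    rw [hx, smul_eq_mul]
    simp only [u]
    have h3 : (x ^ 2 - a ^ 2) ^ 2 = (x - a) ^ 2 * (x + a) ^ 2 := by ring
    rw [h3, mul_comm ((x - a) ^ 2) ((x + a) ^ 2), ← mul_assoc, div_mul_cancel₀ _ hxne, mul_comm]
  rw [hx']
  exact ⟨mul_le_mul_of_nonneg_right hlo.le (sq_nonneg _),
    mul_le_mul_of_nonneg_right hhi.le (sq_nonneg _)⟩

/-- A stiff-bar energy is comparable to the squared norm of the change of the squared edge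
lengths. -/
theorem IsStiffBar.eventually_energy_bounds {G : SimpleGraph (Fin n)} [DecidableRel G.Adj]
    {p : Config n d} {E : Sym2 (Fin n) → ℝ → ℝ} (hE : IsStiffBar G p E) :
    ∃ c C : ℝ, 0 < c ∧ 0 < C ∧ ∀ᶠ q in 𝓝 p,
      c * ‖edgeSq G q - edgeSq G p‖ ^ 2 ≤ energy G E q - energy G E p ∧
      energy G E q - energy G E p ≤ C * ‖edgeSq G q - edgeSq G p‖ ^ 2 := by
  have h1 : ∀ e : Sym2 (Fin n), ∃ c C : ℝ, 0 < c ∧ 0 < C ∧ (e ∈ G.edgeSet → ∀ᶠ q in 𝓝 p,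
      c * (edgeLength q e ^ 2 - edgeLength p e ^ 2) ^ 2 ≤
        E e (edgeLength q e) - E e (edgeLength p e) ∧
      E e (edgeLength q e) - E e (edgeLength p e) ≤
        C * (edgeLength q e ^ 2 - edgeLength p e ^ 2) ^ 2) := by
    intro e
    by_cases he : e ∈ G.edgeSet
    · obtain ⟨c, C, hc, hC, h⟩ := eventually_potential_bounds (hE.1 e he).1 (hE.1 e he).2.1
        (hE.1 e he).2.2 (hE.2 e he)
      exact ⟨c, C, hc, hC, fun _ => (continuous_edgeLength e).continuousAt.eventually h⟩
    · exact ⟨1, 1, one_pos, one_pos, fun h => absurd h he⟩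
  choose c C hc hC h using h1
  have hall : ∀ᶠ q in 𝓝 p, ∀ e ∈ G.edgeFinset,
      c e * (edgeLength q e ^ 2 - edgeLength p e ^ 2) ^ 2 ≤
        E e (edgeLength q e) - E e (edgeLength p e) ∧
      E e (edgeLength q e) - E e (edgeLength p e) ≤
        C e * (edgeLength q e ^ 2 - edgeLength p e ^ 2) ^ 2 := by
    rw [Filter.eventually_all_finset]
    intro e he
    exact h e (SimpleGraph.mem_edgeFinset.1 he)
  -- The summand `1` keeps the constants positive when there are no edges. The norm on edge vectors
  -- is the supremum norm, so each edge is bounded separately.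
  have hM : 0 < ∑ e ∈ G.edgeFinset, (c e)⁻¹ + 1 :=
    add_pos_of_nonneg_of_pos (Finset.sum_nonneg fun e _ => (inv_pos.2 (hc e)).le) one_pos
  have hN : 0 < ∑ e ∈ G.edgeFinset, C e + 1 :=
    add_pos_of_nonneg_of_pos (Finset.sum_nonneg fun e _ => (hC e).le) one_pos
  refine ⟨_, _, inv_pos.2 hM, hN, ?_⟩
  filter_upwards [hall] with q hq
  have hdiff : energy G E q - energy G E p =
      ∑ e ∈ G.edgeFinset, (E e (edgeLength q e) - E e (edgeLength p e)) := by
    simp [energy]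
  rw [hdiff]
  have hnn : ∀ e ∈ G.edgeFinset, 0 ≤ E e (edgeLength q e) - E e (edgeLength p e) := fun e he =>
    (mul_nonneg (hc e).le (sq_nonneg _)).trans (hq e he).1
  have hsum := Finset.sum_nonneg hnn
  set S := ∑ e ∈ G.edgeFinset, (E e (edgeLength q e) - E e (edgeLength p e))
  constructor
  · rw [inv_mul_le_iff₀ hM]
    have hle : ‖edgeSq G q - edgeSq G p‖ ≤
        Real.sqrt ((∑ e ∈ G.edgeFinset, (c e)⁻¹ + 1) * S) := by
      refine (pi_norm_le_iff_of_nonneg (Real.sqrt_nonneg _)).2 ?_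
      rintro ⟨e, he⟩
      have he' := SimpleGraph.mem_edgeFinset.2 he
      refine Real.le_sqrt_of_sq_le ?_
      rw [Real.norm_eq_abs, sq_abs]
      change (edgeLength q e ^ 2 - edgeLength p e ^ 2) ^ 2 ≤ _
      have h3 : (edgeLength q e ^ 2 - edgeLength p e ^ 2) ^ 2 ≤ (c e)⁻¹ * S := by
        rw [le_inv_mul_iff₀ (hc e)]
        exact (hq e he').1.trans (Finset.single_le_sum hnn he')
      have h4 : (c e)⁻¹ ≤ ∑ e ∈ G.edgeFinset, (c e)⁻¹ :=
        Finset.single_le_sum (f := fun e => (c e)⁻¹) (fun e _ => (inv_pos.2 (hc e)).le) he'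
      exact h3.trans (mul_le_mul_of_nonneg_right (by linarith) hsum)
    have := pow_le_pow_left₀ (norm_nonneg _) hle 2
    rwa [Real.sq_sqrt (by positivity)] at this
  · have h3 : S ≤ ∑ e ∈ G.edgeFinset, C e * ‖edgeSq G q - edgeSq G p‖ ^ 2 := by
      refine Finset.sum_le_sum fun e he => (hq e he).2.trans ?_
      refine mul_le_mul_of_nonneg_left ?_ (hC e).le
      have := norm_le_pi_norm (edgeSq G q - edgeSq G p) ⟨e, SimpleGraph.mem_edgeFinset.1 he⟩
      rw [← sq_abs]
      exact pow_le_pow_left₀ (abs_nonneg _) this 2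
    rw [← Finset.sum_mul] at h3
    have := sq_nonneg ‖edgeSq G q - edgeSq G p‖
    linarith

end BarFramework

/-! ### Pinned position and congruence -/

namespace BarFramework

variable {n d : ℕ}

/-- The span of the first `r` coordinate vectors. -/
def coordSpace (d r : ℕ) : Submodule ℝ (EuclideanSpace ℝ (Fin d)) where
  carrier := {x | ∀ c : Fin d, r ≤ (c : ℕ) → x c = 0}
  add_mem' {a b} ha hb c hc := by simp [ha c hc, hb c hc]
  zero_mem' c hc := by simp
  smul_mem' s a ha c hc := by simp [ha c hc]

theorem coordSpace_mono {r s : ℕ} (h : r ≤ s) : coordSpace d r ≤ coordSpace d s :=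
  fun _ hx c hc => hx c (h.trans hc)

theorem finrank_coordSpace_le (r : ℕ) : Module.finrank ℝ (coordSpace d r) ≤ r := by
  let T : coordSpace d r →ₗ[ℝ] (Fin r → ℝ) :=
    { toFun := fun x j => if h : (j : ℕ) < d then (x : EuclideanSpace ℝ (Fin d)) ⟨j, h⟩ else 0
      map_add' := fun x y => by
        ext j
        by_cases h : (j : ℕ) < d <;> simp [h]
      map_smul' := fun a x => by
        ext j
        by_cases h : (j : ℕ) < d <;> simp [h] }
  have hT : Function.Injective T := by
    intro x y hxy
    ext c
    by_cases hc : (c : ℕ) < r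
    · have := congrFun hxy ⟨c, hc⟩
      simpa [T] using this
    · rw [x.2 c (not_lt.1 hc), y.2 c (not_lt.1 hc)]
  simpa using LinearMap.finrank_le_finrank_of_injective hT

theorem spanDim_lt (hn : 0 < n) (p : Config n d) : spanDim p < n := by
  have := finrank_vectorSpan_range_le ℝ (fun i : Fin n => point p i) (n := n - 1)
    (by simp; omega)
  unfold spanDim
  omega

theorem IsPinnedAt.point_mem {l : ℕ} {q : Config n d} (h : IsPinnedAt l q) {i : Fin n}
    (hi : (i : ℕ) ≤ l) : point q i ∈ coordSpace d i := fun c hc => h i hi c hc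

theorem IsPinnedAt.point_zero {l : ℕ} {q : Config n d} (h : IsPinnedAt l q) (hn : 0 < n) :
    point q ⟨0, hn⟩ = 0 := by
  ext c
  exact h ⟨0, hn⟩ (Nat.zero_le _) c (Nat.zero_le _)

theorem IsPinned.affineIndependent_initial {p : Config n d} (hp : IsPinned p) {r : ℕ}
    (hr : r ≤ spanDim p) (hrn : r < n) :
    AffineIndependent ℝ (fun j : Fin (r + 1) => point p ⟨j, by omega⟩) := by
  let f : Fin (r + 1) ↪ {i : Fin n // (i : ℕ) ≤ spanDim p} :=
    ⟨fun j => ⟨⟨j, by omega⟩, show (j : ℕ) ≤ spanDim p by omega⟩, fun a b hab => by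
      simpa [Fin.ext_iff] using hab⟩
  exact hp.1.comp_embedding f

theorem vectorSpan_range_le_of_forall_mem {ι : Type*} {f : ι → EuclideanSpace ℝ (Fin d)}
    {S : Submodule ℝ (EuclideanSpace ℝ (Fin d))} (h : ∀ i, f i ∈ S) :
    vectorSpan ℝ (range f) ≤ S := by
  rw [vectorSpan_def, Submodule.span_le]
  rintro _ ⟨_, ⟨i, rfl⟩, _, ⟨j, rfl⟩, rfl⟩
  exact S.sub_mem (h i) (h j)

/-- The coordinates of the pinned points form a triangular matrix with non-zero diagonal. -/
theorem IsPinned.diag_ne_zero {p : Config n d} (hp : IsPinned p) {i : Fin n} {c : Fin d}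
    (hic : (i : ℕ) = c + 1) (hi : (i : ℕ) ≤ spanDim p) : point p i c ≠ 0 := by
  intro h0
  have hind := hp.affineIndependent_initial hi i.2
  have h1 := hind.finrank_vectorSpan (n := (i : ℕ)) (by simp)
  -- With a zero diagonal entry, the `i + 1` affinely independent points would lie in a space of
  -- dimension at most `c = i - 1`.
  have hle : vectorSpan ℝ (range fun j : Fin ((i : ℕ) + 1) => point p ⟨j, by omega⟩) ≤
      coordSpace d c := by
    refine vectorSpan_range_le_of_forall_mem fun j => ?_
    by_cases hj : (j : ℕ) = i
    · have hji : (⟨j, by omega⟩ : Fin n) = i := Fin.ext hj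
      rw [hji]
      intro c' hc'
      rcases hc'.eq_or_lt with h | h
      · rwa [← Fin.ext h]
      · exact hp.2 i hi c' (by omega)
    · refine coordSpace_mono ?_ (hp.2.point_mem (i := ⟨j, by omega⟩) ?_)
      · change (j : ℕ) ≤ c
        omega
      · change (j : ℕ) ≤ spanDim p
        omega
  have h2 := Submodule.finrank_mono hle
  have h3 := finrank_coordSpace_le (d := d) c
  omega

/-- The first `ℓ + 1` points already span a direction space of the full dimension `ℓ`, so it
contains all differences of points. -/
theorem IsPinned.point_mem {p : Config n d} (hp : IsPinned p) (i : Fin n) :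
    point p i ∈ coordSpace d (spanDim p) := by
  have hn : 0 < n := i.pos
  have hl := spanDim_lt hn p
  have hind := hp.affineIndependent_initial le_rfl hl
  have heq := Submodule.eq_of_le_of_finrank_eq
    (vectorSpan_mono ℝ (show (range fun j : Fin (spanDim p + 1) => point p ⟨j, by omega⟩) ⊆
      range fun i : Fin n => point p i by
        rintro _ ⟨j, rfl⟩
        exact ⟨_, rfl⟩))
    (hind.finrank_vectorSpan (n := spanDim p) (by simp))
  have hle : vectorSpan ℝ (range fun j : Fin (spanDim p + 1) => point p ⟨j, by omega⟩) ≤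
      coordSpace d (spanDim p) := by
    refine vectorSpan_range_le_of_forall_mem fun j => ?_
    have hj : (j : ℕ) ≤ spanDim p := by omega
    exact coordSpace_mono hj (hp.2.point_mem (i := ⟨j, by omega⟩) hj)
  rw [heq] at hle
  have hmem := hle (vsub_mem_vectorSpan ℝ (mem_range_self i) (mem_range_self (⟨0, hn⟩ : Fin n)))
  simpa [hp.2.point_zero hn] using hmem

/-- A vector orthogonal to the first pinned points has vanishing first coordinates. -/
theorem IsPinned.coord_eq_zero_of_inner {p : Config n d} (hp : IsPinned p)
    {x : EuclideanSpace ℝ (Fin d)} {r : ℕ}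
    (hx : ∀ j : Fin n, (j : ℕ) ≤ r → inner ℝ x (point p j) = 0) (hr : r ≤ spanDim p) (hrn : r < n) :
    ∀ c : Fin d, (c : ℕ) < r → x c = 0 := by
  have hmain : ∀ m : ℕ, ∀ c : Fin d, (c : ℕ) = m → (c : ℕ) < r → x c = 0 := by
    intro m
    induction m using Nat.strong_induction_on with
    | _ m ih =>
      intro c hcm hcr
      -- Forward substitution: the last possibly non-zero coordinate of point `c + 1` is `c`, and it
      -- is non-zero.
      have hj := hx ⟨c + 1, by omega⟩ hcr
      rw [PiLp.inner_apply, Finset.sum_eq_single c] at hj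
      · have hne := hp.diag_ne_zero (i := ⟨c + 1, by omega⟩) (c := c) rfl
          (show (c : ℕ) + 1 ≤ spanDim p by omega)
        simpa [hne] using hj
      · intro c' _ hne
        rcases lt_or_ge (c' : ℕ) c with h | h
        · simp [ih c' (by omega) c' rfl (by omega)]
        · have hlt : (c : ℕ) < c' := lt_of_le_of_ne h fun h' => hne (Fin.ext h'.symm)
          have : point p ⟨c + 1, by omega⟩ c' = 0 :=
            hp.2 ⟨c + 1, by omega⟩ (show (c : ℕ) + 1 ≤ spanDim p by omega) c' hlt
          simp [this]
      · simp
  exact fun c hc => hmain c c rfl hc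

/-- Near a pinned configuration, congruent pinned configurations coincide. -/
theorem IsPinned.eventually_eq_of_isCongruent {p : Config n d} (hp : IsPinned p) :
    ∀ᶠ q in 𝓝 p, IsPinnedAt (spanDim p) q → IsCongruent p q → q = p := by
  -- Nearness to `p` serves only to fix signs of coordinates, which excludes reflections.
  have hev : ∀ᶠ q : Config n d in 𝓝 p, ∀ i c, p (i, c) ≠ 0 → 0 < q (i, c) * p (i, c) := by
    rw [eventually_all]; intro i
    rw [eventually_all]; intro c
    by_cases h : p (i, c) = 0
    · simp [h]
    · have hc : ContinuousAt (fun q : Config n d => q (i, c) * p (i, c)) p := by fun_prop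
      filter_upwards [hc.eventually_const_lt (mul_self_pos.2 h)] with q hq _ using hq
  filter_upwards [hev] with q hq hqp hcong
  have hmain : ∀ m : ℕ, ∀ i : Fin n, (i : ℕ) = m → point q i = point p i := by
    intro m
    induction m using Nat.strong_induction_on with
    | _ m ih =>
      intro i him
      have hn : 0 < n := i.pos
      have hl := spanDim_lt hn p
      have hnorm : ∀ j, ‖point q j‖ = ‖point p j‖ := fun j => by
        have := hcong j ⟨0, hn⟩
        rw [hp.2.point_zero hn, hqp.point_zero hn, sub_zero, sub_zero] at this
        exact this.symm
      have hinner : ∀ j, inner ℝ (point q i) (point q j) = inner ℝ (point p i) (point p j) := by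
        intro j
        rw [real_inner_eq_norm_mul_self_add_norm_mul_self_sub_norm_sub_mul_self_div_two,
          real_inner_eq_norm_mul_self_add_norm_mul_self_sub_norm_sub_mul_self_div_two,
          hnorm, hnorm, hcong i j]
      set x := point q i - point p i with hxdef
      have horth : ∀ j : Fin n, (j : ℕ) < m → inner ℝ x (point p j) = 0 := by
        intro j hj
        rw [hxdef, inner_sub_left, ← hinner j, ih j hj j rfl, sub_self]
      -- This makes `x` orthogonal to `point p i`, so Pythagoras and equality of norms force `x =
      -- 0`. For `m ≤ ℓ`, earlier points settle the coordinates below `m - 1`, norm and sign settle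
      -- `m - 1`, and pinning the rest. For `m > ℓ`, `point p i` has no coordinates from `ℓ` on.
      have hzero : ∀ c : Fin d, x c = 0 ∨ point p i c = 0 := by
        intro c
        by_cases hml : m ≤ spanDim p
        · rcases lt_or_ge (c : ℕ) (m - 1) with hc | hc
          · exact Or.inl (hp.coord_eq_zero_of_inner (r := m - 1) (fun j hj => horth j (by omega))
              (by omega) (by omega) c hc)
          · rcases lt_or_ge (c : ℕ) m with hc' | hc'
            · left
              have hrest : ∀ c' : Fin d, c' ≠ c → point q i c' = point p i c' := by
                intro c' hne
                rcases lt_or_ge (c' : ℕ) c with h | h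
                · exact sub_eq_zero.1 (hp.coord_eq_zero_of_inner (r := m - 1)
                    (fun j hj => horth j (by omega)) (by omega) (by omega) c' (by omega))
                · have hlt : (c : ℕ) < c' := lt_of_le_of_ne h fun h' => hne (Fin.ext h'.symm)
                  rw [hp.2 i (by omega) c' (by omega), hqp i (by omega) c' (by omega)]
              have hsq : ‖point q i‖ ^ 2 - ‖point p i‖ ^ 2 = 0 := by rw [hnorm, sub_self]
              rw [EuclideanSpace.real_norm_sq_eq, EuclideanSpace.real_norm_sq_eq,
                ← Finset.sum_sub_distrib, Finset.sum_eq_single c] at hsq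
              · have hpos : 0 < point q i c * point p i c :=
                  hq i c (hp.diag_ne_zero (by omega) (by omega))
                rcases sq_eq_sq_iff_eq_or_eq_neg.1 (sub_eq_zero.1 hsq) with h | h
                · exact sub_eq_zero.2 h
                · rw [h] at hpos
                  nlinarith [sq_nonneg (point p i c)]
              · intro c' _ hne
                rw [hrest c' hne, sub_self]
              · simp
            · exact Or.inr (hp.2 i (by omega) c (by omega))
        · rcases lt_or_ge (c : ℕ) (spanDim p) with hc | hc
          · exact Or.inl (hp.coord_eq_zero_of_inner (r := spanDim p)
              (fun j hj => horth j (by omega)) le_rfl hl c hc)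
          · exact Or.inr (hp.point_mem i c hc)
      have hxp : inner ℝ (point p i) x = 0 := by
        rw [PiLp.inner_apply]
        refine Finset.sum_eq_zero fun c _ => ?_
        rcases hzero c with h | h <;> simp [h]
      have hadd : point q i = point p i + x := by rw [hxdef]; abel
      have h1 := norm_add_sq_real (point p i) x
      rw [← hadd, hxp, hnorm] at h1
      have h2 : ‖x‖ = 0 := by
        have : ‖x‖ ^ 2 = 0 := by linarith
        simpa using this
      exact sub_eq_zero.1 (norm_eq_zero.1 h2)
  ext ⟨i, c⟩
  exact congrArg (fun x : EuclideanSpace ℝ (Fin d) => x c) (hmain i i rfl)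

/-! ### Moving a configuration to pinned position by Gram–Schmidt -/

section Pinning

open InnerProductSpace

theorem continuousAt_gramSchmidt {X E : Type*} [TopologicalSpace X] [NormedAddCommGroup E]
    [InnerProductSpace ℝ E] {f : X → Fin d → E} {x : X} (hf : ∀ c, ContinuousAt (fun y => f y c) x)
    (h0 : ∀ c, gramSchmidt ℝ (f x) c ≠ 0) (c : Fin d) :
    ContinuousAt (fun y => gramSchmidt ℝ (f y) c) x := by
  induction c using WellFoundedLT.induction with
  | _ c ih =>
    simp only [gramSchmidt_def ℝ _ c, Submodule.starProjection_singleton]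
    refine (hf c).sub (tendsto_finsetSum _ fun b hb => ?_)
    have hb' := ih b (Finset.mem_Iio.1 hb)
    refine ContinuousAt.smul (ContinuousAt.div (hb'.inner (hf c)) ?_ ?_) hb'
    · exact hb'.norm.pow 2
    · simpa using h0 b

/-- The edge vectors from the first point to the next `l` ones, completed by coordinate vectors. -/
noncomputable def pinningFrame (l : ℕ) (hl : l < n) (q : Config n d) (c : Fin d) :
    EuclideanSpace ℝ (Fin d) :=
  if h : (c : ℕ) < l then point q ⟨c + 1, by omega⟩ - point q ⟨0, by omega⟩
  else EuclideanSpace.single c 1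

theorem continuous_pinningFrame (l : ℕ) (hl : l < n) (c : Fin d) :
    Continuous fun q : Config n d => pinningFrame l hl q c := by
  unfold pinningFrame
  split_ifs
  · exact (continuous_point _).sub (continuous_point _)
  · exact continuous_const

theorem IsPinned.pinningFrame_mem {p : Config n d} (hp : IsPinned p) (hl : spanDim p < n)
    (c : Fin d) : pinningFrame (spanDim p) hl p c ∈ coordSpace d (c + 1) := by
  unfold pinningFrame
  split_ifs with h
  · rw [hp.2.point_zero, sub_zero]
    exact hp.2.point_mem (i := ⟨c + 1, by omega⟩) h
  · intro c' hc'
    have : c' ≠ c := fun h => by omega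
    simp [this]

theorem IsPinned.pinningFrame_diag {p : Config n d} (hp : IsPinned p) (hl : spanDim p < n)
    (c : Fin d) : pinningFrame (spanDim p) hl p c c ≠ 0 := by
  unfold pinningFrame
  split_ifs with h
  · rw [hp.2.point_zero, sub_zero]
    exact hp.diag_ne_zero (i := ⟨c + 1, by omega⟩) rfl h
  · simp

theorem IsPinned.gramSchmidt_mem {p : Config n d} (hp : IsPinned p) (hl : spanDim p < n)
    (c : Fin d) : gramSchmidt ℝ (pinningFrame (spanDim p) hl p) c ∈ coordSpace d (c + 1) := by
  have h := gramSchmidt_mem_span ℝ (pinningFrame (spanDim p) hl p) (le_refl c)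
  refine (Submodule.span_le.2 ?_) h
  rintro _ ⟨b, hb, rfl⟩
  have hb : b ≤ c := hb
  exact coordSpace_mono (by simpa using hb) (hp.pinningFrame_mem hl b)

/-- Otherwise the frame vector would combine earlier ones and lose its non-zero diagonal coordinate.
Non-vanishing is what makes Gram–Schmidt continuous at `p`. -/
theorem IsPinned.gramSchmidt_ne_zero {p : Config n d} (hp : IsPinned p) (hl : spanDim p < n)
    (c : Fin d) : gramSchmidt ℝ (pinningFrame (spanDim p) hl p) c ≠ 0 := by
  intro h
  have h1 := gramSchmidt_def'' ℝ (pinningFrame (spanDim p) hl p) c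
  rw [h, zero_add] at h1
  refine hp.pinningFrame_diag hl c ?_
  have hmem : pinningFrame (spanDim p) hl p c ∈ coordSpace d c := by
    rw [h1]
    refine Submodule.sum_mem _ fun b hb => Submodule.smul_mem _ _ ?_
    exact coordSpace_mono (Finset.mem_Iio.1 hb) (hp.gramSchmidt_mem hl b)
  exact hmem c le_rfl

theorem gramSchmidtNormed_ne_zero_of_ne_zero {E : Type*} [NormedAddCommGroup E]
    [InnerProductSpace ℝ E] {f : Fin d → E} {c : Fin d} (h : gramSchmidt ℝ f c ≠ 0) :
    gramSchmidtNormed ℝ f c ≠ 0 := by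
  simp [gramSchmidtNormed, h]

/-- The orthonormal basis adapted to the flag spanned by the first points of `q`. -/
noncomputable def pinningBasis (l : ℕ) (hl : l < n) (q : Config n d) :
    OrthonormalBasis (Fin d) ℝ (EuclideanSpace ℝ (Fin d)) :=
  gramSchmidtOrthonormalBasis (by simp) (pinningFrame l hl q)

/-- The isometry taking the adapted basis of `q` to that of `p`. -/
noncomputable def pinningIsometry (l : ℕ) (hl : l < n) (p q : Config n d) :
    EuclideanSpace ℝ (Fin d) ≃ₗᵢ[ℝ] EuclideanSpace ℝ (Fin d) :=
  (pinningBasis l hl q).repr.trans (pinningBasis l hl p).repr.symm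

theorem pinningIsometry_apply (l : ℕ) (hl : l < n) (p q : Config n d)
    (x : EuclideanSpace ℝ (Fin d)) :
    pinningIsometry l hl p q x =
      ∑ c, inner ℝ (pinningBasis l hl q c) x • pinningBasis l hl p c := by
  have := (pinningBasis l hl p).sum_repr_symm ((pinningBasis l hl q).repr x)
  simp only [OrthonormalBasis.repr_apply_apply] at this
  exact this.symm

/-- The congruent copy of `q` in `ℓ`-pinned position. -/
noncomputable def pinning (l : ℕ) (hl : l < n) (p q : Config n d) : Config n d :=
  WithLp.toLp 2 fun x => pinningIsometry l hl p q (point q x.1 - point q ⟨0, by omega⟩) x.2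

theorem point_pinning (l : ℕ) (hl : l < n) (p q : Config n d) (i : Fin n) :
    point (pinning l hl p q) i =
      pinningIsometry l hl p q (point q i - point q ⟨0, by omega⟩) := rfl

theorem isCongruent_pinning (l : ℕ) (hl : l < n) (p q : Config n d) :
    IsCongruent q (pinning l hl p q) := by
  intro i j
  rw [point_pinning, point_pinning, ← map_sub, LinearIsometryEquiv.norm_map]
  congr 1
  abel

theorem IsPinned.pinningBasis_mem {p : Config n d} (hp : IsPinned p) (hl : spanDim p < n)
    (c : Fin d) : pinningBasis (spanDim p) hl p c ∈ coordSpace d (c + 1) := by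
  rw [pinningBasis, gramSchmidtOrthonormalBasis_apply _
    (gramSchmidtNormed_ne_zero_of_ne_zero (hp.gramSchmidt_ne_zero hl c))]
  exact Submodule.smul_mem _ _ (hp.gramSchmidt_mem hl c)

/-- The edge vector from point `0` to point `i` is frame vector `i - 1`, hence involves only the
first `i` vectors of the basis of `q`, whose images lie in the span of the first `i` coordinate
vectors. No closeness of `q` to `p` is needed. -/
theorem IsPinned.isPinnedAt_pinning {p : Config n d} (hp : IsPinned p) (hl : spanDim p < n)
    (q : Config n d) : IsPinnedAt (spanDim p) (pinning (spanDim p) hl p q) := by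
  intro i hi
  change point (pinning (spanDim p) hl p q) i ∈ coordSpace d i
  rw [point_pinning]
  rcases Nat.eq_zero_or_pos (i : ℕ) with h0 | hpos
  · have : i = ⟨0, by omega⟩ := Fin.ext h0
    rw [← this, sub_self, map_zero]
    exact Submodule.zero_mem _
  rw [pinningIsometry_apply]
  refine Submodule.sum_mem _ fun c _ => ?_
  rcases lt_or_ge (c : ℕ) i with hc | hc
  · exact Submodule.smul_mem _ _ (coordSpace_mono hc (hp.pinningBasis_mem hl c))
  · let b : Fin d := ⟨i - 1, by omega⟩
    have hb : b < c := Fin.lt_def.2 (show (i : ℕ) - 1 < c by omega)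
    have hframe : pinningFrame (spanDim p) hl q b = point q i - point q ⟨0, by omega⟩ := by
      have hbl : (b : ℕ) < spanDim p := show (i : ℕ) - 1 < spanDim p by omega
      have hbi : (⟨b + 1, by omega⟩ : Fin n) = i := Fin.ext (show (i : ℕ) - 1 + 1 = i by omega)
      rw [pinningFrame, dif_pos hbl, hbi]
    have horth := gramSchmidtOrthonormalBasis_inv_triangular (𝕜 := ℝ)
      (h := by simp) (pinningFrame (spanDim p) hl q) hb
    rw [hframe] at horth
    rw [pinningBasis, horth, zero_smul]
    exact Submodule.zero_mem _

theorem IsPinned.pinning_self {p : Config n d} (hp : IsPinned p) (hl : spanDim p < n) :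
    pinning (spanDim p) hl p p = p := by
  ext ⟨i, c⟩
  change point (pinning (spanDim p) hl p p) i c = point p i c
  rw [point_pinning, hp.2.point_zero, sub_zero, pinningIsometry]
  simp

theorem IsPinned.continuousAt_pinning {p : Config n d} (hp : IsPinned p) (hl : spanDim p < n) :
    ContinuousAt (pinning (spanDim p) hl p) p := by
  have hgs : ∀ c, ContinuousAt
      (fun q => gramSchmidt ℝ (pinningFrame (spanDim p) hl q) c) p :=
    continuousAt_gramSchmidt (fun c => (continuous_pinningFrame _ hl c).continuousAt)
      (hp.gramSchmidt_ne_zero hl)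
  have hbasis : ∀ c, ContinuousAt (fun q => pinningBasis (spanDim p) hl q c) p := by
    intro c
    have h1 : ContinuousAt
        (fun q => gramSchmidtNormed ℝ (pinningFrame (spanDim p) hl q) c) p := by
      have h2 := (hgs c).norm.inv₀ (norm_ne_zero_iff.2 (hp.gramSchmidt_ne_zero hl c))
      exact h2.smul (hgs c)
    -- The orthonormal basis is given by the normalised Gram–Schmidt vectors where these are
    -- non-zero, which holds near `p`.
    refine h1.congr ?_
    filter_upwards [(hgs c).eventually_ne (hp.gramSchmidt_ne_zero hl c)] with q hq
    exact (gramSchmidtOrthonormalBasis_apply _ (gramSchmidtNormed_ne_zero_of_ne_zero hq)).symm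
  have hpt : ∀ i, ContinuousAt (fun q => point (pinning (spanDim p) hl p q) i) p := by
    intro i
    simp only [point_pinning, pinningIsometry_apply]
    refine tendsto_finsetSum _ fun c _ => ?_
    have hd : Continuous fun q : Config n d => point q i - point q ⟨0, by omega⟩ :=
      (continuous_point _).sub (continuous_point _)
    exact ((hbasis c).inner (𝕜 := ℝ) hd.continuousAt).smul_const _
  have hcoord : ContinuousAt
      (fun q => fun x : Fin n × Fin d => point (pinning (spanDim p) hl p q) x.1 x.2) p := by
    refine continuousAt_pi.2 fun x => ?_
    exact (EuclideanSpace.proj x.2 : EuclideanSpace ℝ (Fin d) →L[ℝ] ℝ).continuous.continuousAt.comp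
      (hpt x.1)
  exact (PiLp.continuous_toLp 2 _).continuousAt.comp hcoord

end Pinning

end BarFramework

/-! ### Rigidity, growth and the dichotomy -/

namespace BarFramework

variable {n d : ℕ} {G : SimpleGraph (Fin n)} {p : Config n d}

theorem IsCongruent.isEquivalent {q r : Config n d} (h : IsCongruent q r) : IsEquivalent G q r := by
  intro e _
  induction e with
  | h i j => exact h i j

/-- Rigidity can be tested on pinned configurations. -/
theorem IsPinned.isRigid (hp : IsPinned p) (hn : 0 < n)
    (h : ∀ᶠ q in 𝓝 p, IsPinnedAt (spanDim p) q → IsEquivalent G p q → q = p) : IsRigid G p := by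
  have hl := spanDim_lt hn p
  have hc : Tendsto (pinning (spanDim p) hl p) (𝓝 p) (𝓝 p) := by
    simpa [hp.pinning_self hl] using (hp.continuousAt_pinning hl).tendsto
  refine ⟨_, hc h, fun q hq heq => ?_⟩
  have hcong := isCongruent_pinning (spanDim p) hl p q
  have h1 : pinning (spanDim p) hl p q = p := hq (hp.isPinnedAt_pinning hl q)
    fun e he => (heq e he).trans (hcong.isEquivalent e he)
  rw [h1] at hcong
  exact fun i j => (hcong i j).symm

/-- A pinned motion with non-zero velocity that preserves the edge lengths is a flex. -/
theorem IsPinned.isFlexible (hp : IsPinned p) {γ : ℝ → Config n d} {v : Config n d}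
    (h0 : γ 0 = p) (hd : HasDerivAt γ v 0) (hv : v ≠ 0)
    (hpin : ∀ t, IsPinnedAt (spanDim p) (γ t)) (heq : ∀ᶠ t in 𝓝 0, IsEquivalent G p (γ t)) :
    IsFlexible G p := by
  rintro ⟨U, hU, hrig⟩
  have hc : Tendsto γ (𝓝 0) (𝓝 p) := h0 ▸ hd.continuousAt.tendsto
  obtain ⟨c, hcpos, hlow⟩ := eventually_mul_abs_le_norm_sub hd hv
  have hall : ∀ᶠ t in 𝓝[>] (0 : ℝ), t ≤ 0 := by
    refine nhdsWithin_le_nhds ?_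
    filter_upwards [hc hU, heq, hlow, hc hp.eventually_eq_of_isCongruent] with t h1 h2 h3 h4
    have h5 : γ t = p := h4 (hpin t) (hrig _ h1 h2)
    rw [h5, h0, sub_self, norm_zero] at h3
    have h6 : |t| ≤ 0 := by
      by_contra hcon
      have := mul_pos hcpos (not_le.1 hcon)
      linarith
    exact (le_abs_self t).trans h6
  obtain ⟨t, ht, ht'⟩ := (hall.and self_mem_nhdsWithin).exists
  exact absurd ht (not_le.2 ht')

theorem HasFlex.of_le {j k k' : ℕ} (h : HasFlex G p j k) (hk' : 1 ≤ k') (hle : k' ≤ k) :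
    HasFlex G p j k' := by
  obtain ⟨γ, h1, h2, h3, h4, h5⟩ := h
  exact ⟨γ, h1, hk', h3, h4, fun e he i hi hik => h5 e he i hi (hik.trans hle)⟩

variable [DecidableRel G.Adj]

/-- The change of the squared edge lengths near `p` in pinned position is at least of the order
`‖q - p‖ ^ m`. -/
def EdgeSqGrows (G : SimpleGraph (Fin n)) [DecidableRel G.Adj] (p : Config n d) (m : ℕ) : Prop :=
  ∃ c : ℝ, 0 < c ∧ ∀ᶠ q in 𝓝 p, IsPinnedAt (spanDim p) q →
    c * ‖q - p‖ ^ m ≤ ‖edgeSq G q - edgeSq G p‖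

theorem EdgeSqGrows.isRigid {m : ℕ} (h : EdgeSqGrows G p m) (hp : IsPinned p) (hn : 0 < n) :
    IsRigid G p := by
  obtain ⟨c, hc, hev⟩ := h
  refine hp.isRigid hn ?_
  filter_upwards [hev] with q hq hpin heq
  have h1 := hq hpin
  rw [(isEquivalent_iff_edgeSq_eq G).1 heq, sub_self, norm_zero] at h1
  by_contra hne
  have h2 := mul_pos hc (pow_pos (norm_pos_iff.2 (sub_ne_zero.2 hne)) m)
  linarith

/-- A `(1,k)`-flex moves at least linearly in `t` and changes squared edge lengths by `O(t ^ (k +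
1))`, whereas growth demands a multiple of `t ^ m`. Only `t > 0` is used, where the flex is pinned.
-/
theorem EdgeSqGrows.succ_le {m k : ℕ} (h : EdgeSqGrows G p m) (hflex : HasFlex G p 1 k) :
    k + 1 ≤ m := by
  obtain ⟨c, hc, hev⟩ := h
  obtain ⟨γ, hγ⟩ := hflex
  have htr := hγ.2.2.1
  obtain ⟨a, ha, hlow⟩ := eventually_mul_abs_le_norm_sub hγ.hasDerivAt
    (isActive_one_iff.1 hγ.2.2.2.1)
  obtain ⟨C, hC, hup⟩ := hγ.edgeSq_isBigO
  have hcont : Tendsto γ (𝓝 0) (𝓝 p) := by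
    simpa [htr.apply_zero] using htr.analyticAt.continuousAt.tendsto
  by_contra hlt
  have hA : 0 < c * a ^ m / C := by positivity
  have hall : ∀ᶠ t in 𝓝[>] (0 : ℝ), t < c * a ^ m / C ∧ c * a ^ m / C ≤ t := by
    have hsmall : ∀ᶠ t in 𝓝[>] (0 : ℝ), t ∈ Ioo 0 (min 1 (c * a ^ m / C)) :=
      Ioo_mem_nhdsGT (lt_min one_pos hA)
    filter_upwards [nhdsWithin_le_nhds (hcont hev), nhdsWithin_le_nhds hlow,
      nhdsWithin_le_nhds hup, hsmall,
      nhdsWithin_mono _ Ioi_subset_Ici_self htr.eventually_isPinnedAt] with t h1 h2 h3 h4 h5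
    refine ⟨h4.2.trans_le (min_le_right _ _), ?_⟩
    have ht1 : t ≤ 1 := (h4.2.trans_le (min_le_left _ _)).le
    have ht0 : 0 < t := h4.1
    have h6 : c * ‖γ t - p‖ ^ m ≤ ‖edgeSq G (γ t) - edgeSq G p‖ := h1 h5
    rw [htr.apply_zero] at h2
    rw [abs_of_pos ht0] at h2 h3
    have h7 : (a * t) ^ m ≤ ‖γ t - p‖ ^ m := pow_le_pow_left₀ (by positivity) h2 m
    have h8 : t ^ (k + 1) ≤ t ^ (m + 1) := pow_le_pow_of_le_one ht0.le ht1 (by omega)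
    have h9 : c * a ^ m * t ^ m ≤ t * C * t ^ m := by
      calc c * a ^ m * t ^ m = c * (a * t) ^ m := by rw [mul_pow]; ring
        _ ≤ c * ‖γ t - p‖ ^ m := by gcongr
        _ ≤ C * t ^ (k + 1) := h6.trans h3
        _ ≤ C * t ^ (m + 1) := by gcongr
        _ = t * C * t ^ m := by ring
    rw [div_le_iff₀ hC]
    exact le_of_mul_le_mul_right h9 (by positivity)
  obtain ⟨t, h1, h2⟩ := hall.exists
  linarith

/-- The energy is of the size of the squared edge change, which doubles the exponent: growth gives
the lower bound, the `(1,m-1)`-flex the upper one. -/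
theorem EdgeSqGrows.hasRigidityOrder {m : ℕ} (h : EdgeSqGrows G p m) (hp : IsPinned p)
    (hn : 0 < n) (hm : 2 ≤ m) (hflex : HasFlex G p 1 (m - 1)) :
    HasRigidityOrder G p (m : ℚ) := by
  refine ⟨h.isRigid hp hn, fun E hE => ?_⟩
  have hs : 2 * (((m : ℚ) : ℝ)) = ((2 * m : ℕ) : ℝ) := by push_cast; ring
  rw [hs]
  obtain ⟨b, B, hb, hB, hbounds⟩ := hE.eventually_energy_bounds
  refine ⟨by exact_mod_cast (by omega : 0 < 2 * m), ?_, ?_⟩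
  · obtain ⟨γ, hγ⟩ := hflex
    have htr := hγ.2.2.1
    obtain ⟨a, ha, hlow⟩ := eventually_mul_abs_le_norm_sub hγ.hasDerivAt
      (isActive_one_iff.1 hγ.2.2.2.1)
    obtain ⟨C, hC, hup⟩ := hγ.edgeSq_isBigO
    have hcont : Tendsto γ (𝓝 0) (𝓝 p) := by
      simpa [htr.apply_zero] using htr.analyticAt.continuousAt.tendsto
    have hall : ∀ᶠ t in 𝓝 (0 : ℝ), energy G E (γ t) - energy G E p ≤
        B * (C / a ^ m) ^ 2 * ‖γ t - p‖ ^ (2 * m) := by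
      filter_upwards [hcont hbounds, hlow, hup] with t h1 h2 h3
      rw [htr.apply_zero] at h2
      have hm1 : m - 1 + 1 = m := by omega
      rw [hm1] at h3
      have h4 : |t| ^ m ≤ ‖γ t - p‖ ^ m / a ^ m := by
        rw [le_div_iff₀ (by positivity), ← mul_pow, mul_comm]
        exact pow_le_pow_left₀ (by positivity) h2 m
      calc energy G E (γ t) - energy G E p ≤ B * ‖edgeSq G (γ t) - edgeSq G p‖ ^ 2 := h1.2
        _ ≤ B * (C * (‖γ t - p‖ ^ m / a ^ m)) ^ 2 := by
          gcongr
          exact h3.trans (mul_le_mul_of_nonneg_left h4 hC.le)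
        _ = _ := by ring
    obtain ⟨r, hr, hball⟩ := Metric.eventually_nhds_iff_ball.1 hall
    refine ⟨γ, htr, B * (C / a ^ m) ^ 2, r / 2, by positivity, by positivity, fun t ht => ?_⟩
    rw [Real.rpow_natCast]
    refine hball t ?_
    rw [Metric.mem_ball, dist_zero_right, Real.norm_eq_abs, abs_of_nonneg ht.1]
    linarith [ht.2]
  · obtain ⟨c, hc, hev⟩ := h
    refine ⟨b * c ^ 2, by positivity, _, hbounds.and hev, fun q hq hpin => ?_⟩
    rw [Real.rpow_natCast]
    refine le_trans ?_ hq.1.1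
    have h1 := pow_le_pow_left₀ (by positivity) (hq.2 hpin) 2
    calc b * c ^ 2 * ‖q - p‖ ^ (2 * m) = b * (c * ‖q - p‖ ^ m) ^ 2 := by ring
      _ ≤ _ := by gcongr

/-- If there is a single first-order flex up to scaling, then either `(G, p)` is flexible and has
flexes of all orders, or the squared edge lengths detect displacements at some finite order. -/
theorem IsPinned.flexible_or_edgeSqGrows (hp : IsPinned p)
    (hK : Module.finrank ℝ (firstOrderFlexes G p) = 1) :
    (IsFlexible G p ∧ ∀ k, 1 ≤ k → HasFlex G p 1 k) ∨
      ∃ m, 2 ≤ m ∧ HasFlex G p 1 (m - 1) ∧ EdgeSqGrows G p m := by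
  obtain ⟨v, hv, hker⟩ := exists_ker_eq_span hp.2 hK
  obtain ⟨γ, hγ, h0, hd, hcase⟩ := exists_curve_vanishing_or_growth (analyticAt_edgeMap G p)
    (edgeMap_zero G p) hv hker
  rcases hcase with hzero | ⟨m, hm, hord, c, hc, hgrow⟩
  · left
    constructor
    · refine hp.isFlexible (γ := fun t => p + (γ t : Config n d)) (v := (v : Config n d))
        (by simp [h0])
        (((pinnedSubmodule n d (spanDim p)).subtypeL.hasFDerivAt.comp_hasDerivAt 0 hd).const_add p)
        (by simpa using hv) (fun t => (pinnedSubmodule n d (spanDim p)).add_mem hp.2 (γ t).2) ?_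
      filter_upwards [hzero] with t ht
      exact (isEquivalent_iff_edgeSq_eq G).2 (sub_eq_zero.1 ht)
    · intro k hk
      refine ⟨_, isFlex_one_of_analyticAt hp.2 hγ h0 hd hv hk ?_⟩
      rw [analyticOrderAt_eq_top.2 hzero]
      exact le_top
  · right
    refine ⟨m, hm, ⟨_, isFlex_one_of_analyticAt hp.2 hγ h0 hd hv (by omega) ?_⟩, c, hc, ?_⟩
    · rwa [Nat.sub_add_cancel (by omega)]
    · obtain ⟨r, hr, hball⟩ := Metric.eventually_nhds_iff_ball.1 hgrow
      filter_upwards [Metric.ball_mem_nhds p hr] with q hq hpin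
      have hx : q - p ∈ pinnedSubmodule n d (spanDim p) :=
        (pinnedSubmodule n d (spanDim p)).sub_mem hpin hp.2
      have := hball ⟨q - p, hx⟩ (by simpa [dist_eq_norm] using hq)
      simpa [edgeMap] using this

end BarFramework

theorem mainTheorem2 {n d : ℕ} (G : SimpleGraph (Fin n)) [DecidableRel G.Adj]
    (p : BarFramework.Config n d)
    (hedge : ∀ i j : Fin n, G.Adj i j → BarFramework.point p i ≠ BarFramework.point p j)
    (hpin : BarFramework.IsPinned p)
    (hK : Module.finrank ℝ (BarFramework.firstOrderFlexes G p) = 1) :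
    (∀ k : ℕ, 2 ≤ k → BarFramework.HasFlex G p 1 (k - 1) → ¬ BarFramework.HasFlex G p 1 k →
      BarFramework.HasRigidityOrder G p (k : ℚ)) ∧
    (∀ k : ℕ, 1 ≤ k → BarFramework.HasFlex G p 1 k →
      BarFramework.IsFlexible G p ∨
        ∃ ν : ℚ, BarFramework.HasRigidityOrder G p ν ∧ (k : ℚ) + 1 ≤ ν) ∧
    ((∃ k : ℕ, 1 ≤ k ∧ ¬ BarFramework.HasFlex G p 1 k) → BarFramework.IsRigid G p) := by
  -- Without vertices the configuration space, hence `K`, would be zero.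
  have hn : 0 < n := by
    rcases Nat.eq_zero_or_pos n with rfl | h
    · have : Module.finrank ℝ (BarFramework.firstOrderFlexes G p) = 0 :=
        Module.finrank_zero_of_subsingleton
      omega
    · exact h
  rcases hpin.flexible_or_edgeSqGrows hK with ⟨hflexible, hall⟩ | ⟨m, hm, hflex, hgrow⟩
  · exact ⟨fun k hk _ hno => absurd (hall k (by omega)) hno, fun k _ _ => Or.inl hflexible,
      fun ⟨k, hk, hno⟩ => absurd (hall k hk) hno⟩
  · refine ⟨fun k hk hyes hno => ?_, fun k hk hyes => Or.inr ⟨m, ?_, ?_⟩,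
      fun _ => hgrow.isRigid hpin hn⟩
    · have h1 := hgrow.succ_le hyes
      -- The `(1,k-1)`-flex gives `k ≤ m`; if `k < m`, the `(1,m-1)`-flex would also be a
      -- `(1,k)`-flex.
      have h2 : k = m := by
        by_contra hne
        exact hno (hflex.of_le (by omega) (by omega))
      subst h2
      exact hgrow.hasRigidityOrder hpin hn hm hflex
    · exact hgrow.hasRigidityOrder hpin hn hm hflex
    · exact_mod_cast hgrow.succ_le hyes
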